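/- Let $X$ be a real Banach space with dual $X^*$. Conventions. $X$ is Asplund if every continuous convex function $f:X\to\mathbb R$ is Fréchet differentiable at some point of $X$. For a Banach space $Z$, $\mathcal C(Z)$ is the set of all (at most) countable subsets of $Z$, $\overline{\mathrm{sp}}\,A$ is the closed linear span of $A\subset Z$, and $\mathcal S(Z)$ is the set of all separable closed linear subspaces of $Z$. Let $\mathcal S_{\square}(X\times X^*)$ be the set of all rectangles $V\times Y$ with $V\in\mathcal S(X)$ and $Y\in\mathcal S(X^*)$, ordered by inclusion; its subsets are called rectangle-families. A rectangle-family $\mathcal A$ is cofinal if every rectangle in $\mathcal S_{\square}(X\times X^*)$ is contained in some member of $\mathcal A$; it is $\sigma$-complete if every increasing sequence $V_1\times Y_1\subset V_2\times Y_2\subset\cdots$ in $\mathcal A$ has a least upper bound in $\mathcal S_{\square}(X\times X^*)$ and this least upper bound belongs to $\mathcal A$; it is rich if it is both cofinal and $\sigma$-complete. An Asplund generator in $X$ is a map $G:\mathcal C(X)\to\mathcal C(X^*)$ such that (a) for every $C\in\mathcal C(X)$, the set $\{x^*|_{\overline{\mathrm{sp}}\,C}:x^*\in G(C)\}$ is norm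 dense in $(\overline{\mathrm{sp}}\,C)^*$; (b) if $C_1\subset C_2\subset\cdots$ are in $\mathcal C(X)$, then $G(C_1\cup C_2\cup\cdots)=G(C_1)\cup G(C_2)\cup\cdots$; (c) $\bigcup\{G(C):C\in\mathcal C(X)\}$ is norm dense in $X^*$; (d) if $C_1,C_2\in\mathcal C(X)$ and $\overline{\mathrm{sp}}\,C_1=\overline{\mathrm{sp}}\,C_2$, then $\overline{\mathrm{sp}}\,G(C_1)=\overline{\mathrm{sp}}\,G(C_2)$. Theorem. The following assertions are equivalent. (i) $X$ is Asplund. (ii) $X$ admits an Asplund generator. (iii) There is a rich rectangle-family $\mathcal A\subset\mathcal S_{\square}(X\times X^*)$ such that $Y_1\subset Y_2$ whenever $V_1\times Y_1,\ V_2\times Y_2\in\mathcal A$ and $V_1\subset V_2$, and such that for every $V\times Y\in\mathcal A$ the restriction map $Y\ni x^*\mapsto x^*|_V\in V^*$ is a surjective isometry. (iv) There is a cofinal rectangle-family $\mathcal A\subset\mathcal S_{\square}(X\times X^*)$ such that for every $V\times Y\in\mathcal A$ the restriction map $Y\ni x^*\mapsto x^*|_V\in V^*$ is surjective. -/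

import Mathlib

open Set

namespace Asplund

/-- A family `R` in a partially ordered set is σ-complete if every increasing sequence of elements
of `R` has a least upper bound (computed in the whole poset) which belongs to `R`. -/
def SigmaComplete {P : Type*} [PartialOrder P] (R : Set P) : Prop :=
  ∀ r : ℕ → P, Monotone r → (∀ n, r n ∈ R) → ∃ s ∈ R, IsLUB (range r) s

/-- A family in a partially ordered set is rich if it is cofinal and σ-complete. -/
def Rich {P : Type*} [PartialOrder P] (R : Set P) : Prop :=
  IsCofinal R ∧ SigmaComplete R

/-- The poset of separable closed linear subspaces of `Z`, ordered by inclusion. -/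
abbrev SepSubspace (Z : Type*) [NormedAddCommGroup Z] [NormedSpace ℝ Z] :=
  {V : Submodule ℝ Z // IsClosed (V : Set Z) ∧ TopologicalSpace.IsSeparable (V : Set Z)}

/-- The poset of rectangles `V × Y`, with `V` a separable closed subspace of `X` and `Y` a separable
closed subspace of the dual of `X`. A rectangle is encoded by its two sides; by
`Rectangle.prod_le_prod_iff` the componentwise order is inclusion of the products `V × Y`. -/
abbrev Rectangle (X : Type*) [NormedAddCommGroup X] [NormedSpace ℝ X] :=
  SepSubspace X × SepSubspace (StrongDual ℝ X)

theorem Rectangle.prod_le_prod_iff {X : Type*} [NormedAddCommGroup X] [NormedSpace ℝ X]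
    (R S : Rectangle X) :
    R.1.1.prod R.2.1 ≤ S.1.1.prod S.2.1 ↔ R ≤ S := by
  constructor
  · intro h
    refine ⟨fun x hx => ?_, fun y hy => ?_⟩
    · exact (h (show (x, (0 : StrongDual ℝ X)) ∈ R.1.1.prod R.2.1 from
        ⟨hx, R.2.1.zero_mem⟩)).1
    · exact (h (show ((0 : X), y) ∈ R.1.1.prod R.2.1 from ⟨R.1.1.zero_mem, hy⟩)).2
  · rintro ⟨h1, h2⟩ ⟨x, y⟩ ⟨hx, hy⟩
    exact ⟨h1 hx, h2 hy⟩

/-- The restriction `x* ↦ x*|_V` of functionals on `X` to a subspace `V`. -/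
def restrict {X : Type*} [NormedAddCommGroup X] [NormedSpace ℝ X] (V : Submodule ℝ X)
    (x : StrongDual ℝ X) : StrongDual ℝ V :=
  x.comp V.subtypeL

/-- The assignment `Y ∋ x* ↦ x*|_V ∈ V*` attached to a rectangle `V × Y`. -/
def Rectangle.restrict {X : Type*} [NormedAddCommGroup X] [NormedSpace ℝ X] (R : Rectangle X)
    (y : R.2.1) : StrongDual ℝ R.1.1 :=
  Asplund.restrict R.1.1 (y : StrongDual ℝ X)

/-- The space `X` is Asplund if every continuous convex function on it is Fréchet differentiable
at some point. -/
def IsAsplund (X : Type*) [NormedAddCommGroup X] [NormedSpace ℝ X] : Prop :=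
  ∀ f : X → ℝ, ConvexOn ℝ univ f → Continuous f → ∃ x : X, DifferentiableAt ℝ f x

/-- The family of all (at most) countable subsets of `Z`. -/
abbrev CountableSubset (Z : Type*) := {C : Set Z // C.Countable}

/-- The union of a sequence of countable sets. -/
def CountableSubset.iUnion {Z : Type*} (C : ℕ → CountableSubset Z) : CountableSubset Z :=
  ⟨⋃ n, (C n).1, countable_iUnion fun n => (C n).2⟩

/-- The closed linear span of a set. -/
def closedSpan {Z : Type*} [NormedAddCommGroup Z] [NormedSpace ℝ Z] (A : Set Z) :
    Submodule ℝ Z :=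
  (Submodule.span ℝ A).topologicalClosure

/-- An Asplund generator in `X`. -/
structure IsAsplundGenerator {X : Type*} [NormedAddCommGroup X] [NormedSpace ℝ X]
    (G : CountableSubset X → CountableSubset (StrongDual ℝ X)) : Prop where
  /-- The restrictions to the closed span of `C` of the members of `G C` are norm dense in the
  dual of the closed span of `C`. -/
  dense_restrict : ∀ C : CountableSubset X,
    Dense (restrict (closedSpan C.1) '' (G C).1)
  iUnion_eq : ∀ C : ℕ → CountableSubset X, Monotone C →
    (G (CountableSubset.iUnion C)).1 = ⋃ n, (G (C n)).1
  dense_iUnion : Dense (⋃ C : CountableSubset X, (G C).1)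
  closedSpan_congr : ∀ C₁ C₂ : CountableSubset X, closedSpan C₁.1 = closedSpan C₂.1 →
    closedSpan (G C₁).1 = closedSpan (G C₂).1

end Asplund

universe u

namespace Asplund

/-- Derivation along the ordinals: if every nonempty closed subset `F` of a compact space has a
nonempty relatively open piece that is small, in the sense that it is contained in some `S e`, then
there is a choice of indices `y` such that every directed family of closed sets `N i` with nonempty
intersection has a member `N i` for which the intersection meets `S (y (N i))`. -/
theorem exists_selection_of_fragmented {K : Type u} {E : Type*} [TopologicalSpace K]
    [CompactSpace K] (S : E → Set K)
    (h : ∀ F : Set K, IsClosed F → F.Nonempty →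
      ∃ U : Set K, IsOpen U ∧ ∃ e, (F ∩ U).Nonempty ∧ F ∩ U ⊆ S e) [Nonempty E] :
    ∃ y : Set K → E, ∀ (ι : Type*) [Nonempty ι] (N : ι → Set K), Directed (· ⊇ ·) N →
      (∀ i, IsClosed (N i)) → (⋂ i, N i).Nonempty → ∃ i, ((⋂ j, N j) ∩ S (y (N i))).Nonempty := by
  classical
  have h' : ∀ F : Set K, ∃ (U : Set K) (e : E), IsOpen U ∧
      (IsClosed F → F.Nonempty → (F ∩ U).Nonempty ∧ F ∩ U ⊆ S e) := by
    intro F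
    by_cases hF : IsClosed F ∧ F.Nonempty
    · obtain ⟨U, hU, e, he⟩ := h F hF.1 hF.2
      exact ⟨U, e, hU, fun _ _ => he⟩
    · exact ⟨∅, Classical.arbitrary E, isOpen_empty, fun h1 h2 => (hF ⟨h1, h2⟩).elim⟩
  choose U e hU he using h'
  let V : Ordinal.{u} → Set K := WellFounded.fix (C := fun _ => Set K) Ordinal.lt_wf
    fun a V => U (⋃ (b) (hb : b < a), V b hb)ᶜ
  have hV : ∀ a, V a = U (⋃ b, ⋃ (_ : b < a), V b)ᶜ := fun a => WellFounded.fix_eq _ _ a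
  have hVo : ∀ a, IsOpen (V a) := fun a => by rw [hV]; exact hU _
  have hcl : ∀ a, IsClosed (⋃ b, ⋃ (_ : b < a), V b)ᶜ := fun a =>
    (isOpen_iUnion fun b => isOpen_iUnion fun _ => hVo b).isClosed_compl
  have hex : ∃ a, (⋃ b, ⋃ (_ : b < a), V b)ᶜ = ∅ := by
    by_contra! hne
    have hp : ∀ a, ((⋃ b, ⋃ (_ : b < a), V b)ᶜ ∩ V a).Nonempty := fun a => by
      have := (he _ (hcl a) (hne a)).1
      rwa [← hV] at this
    choose p hp using hp
    refine not_injective_of_ordinal p (Function.Injective.of_lt_imp_ne fun a b hab heq => ?_)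
    refine (hp b).1 ?_
    rw [← heq]
    exact mem_iUnion₂.2 ⟨a, hab, (hp a).2⟩
  let T : Set K → Set Ordinal := fun N => {a | N ⊆ ⋃ b, ⋃ (_ : b ≤ a), V b}
  have hT : ∀ N, (T N).Nonempty := fun N => by
    obtain ⟨a, ha⟩ := hex
    refine ⟨a, fun x _ => ?_⟩
    have hx : x ∈ (⋃ b, ⋃ (_ : b < a), V b) := by
      rw [compl_empty_iff.1 ha]; trivial
    obtain ⟨b, hb, hx⟩ := mem_iUnion₂.1 hx
    exact mem_iUnion₂.2 ⟨b, hb.le, hx⟩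
  refine ⟨fun N => e (⋃ b, ⋃ (_ : b < sInf (T N)), V b)ᶜ, fun ι _ N hdir hN hne => ?_⟩
  obtain ⟨i, hi⟩ : ∃ i, ∀ j, sInf (T (N i)) ≤ sInf (T (N j)) :=
    ⟨Function.argmin (fun i => sInf (T (N i))),
      fun j => Function.argmin_le (fun i => sInf (T (N i))) j⟩
  refine ⟨i, ?_⟩
  by_contra hcon
  set a := sInf (T (N i)) with ha
  have hsub : (⋂ j, N j) ⊆ ⋃ b, ⋃ (_ : b < a), V b := by
    intro x hx
    by_contra hxa
    obtain ⟨b, hb, hxb⟩ := mem_iUnion₂.1 (csInf_mem (hT (N i)) (mem_iInter.1 hx i))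
    rcases hb.lt_or_eq with hb | hb
    · exact hxa (mem_iUnion₂.2 ⟨b, hb, hxb⟩)
    · refine hcon ⟨x, hx, (he _ (hcl a) ⟨x, hxa⟩).2 ⟨hxa, ?_⟩⟩
      rw [← hV, ha, ← hb]
      exact hxb
  obtain ⟨j, hj⟩ := exists_subset_nhds_of_isCompact' hdir (fun i => (hN i).isCompact) hN
    (U := ⋃ b, ⋃ (_ : b < a), V b) fun x hx =>
      (isOpen_iUnion fun b => isOpen_iUnion fun _ => hVo b).mem_nhds (hsub hx)
  have hne' : Nonempty (Iio a) := by
    obtain ⟨x, hx⟩ := hne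
    obtain ⟨b, hb, -⟩ := mem_iUnion₂.1 (hsub hx)
    exact ⟨⟨b, hb⟩⟩
  obtain ⟨c, hc⟩ := (hN j).isCompact.elim_directed_cover
    (fun c : Iio a => ⋃ b, ⋃ (_ : b ≤ c.1), V b)
    (fun c => isOpen_iUnion fun b => isOpen_iUnion fun _ => hVo b)
    (fun x hx => by
      obtain ⟨b, hb, hxb⟩ := mem_iUnion₂.1 (hj hx)
      exact mem_iUnion.2 ⟨⟨b, hb⟩, mem_iUnion₂.2 ⟨b, le_rfl, hxb⟩⟩)
    (Monotone.directed_le fun c d hcd =>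
      iUnion_mono fun b => iUnion_mono' fun hb => ⟨hb.trans hcd, subset_rfl⟩)
  exact absurd (hi j) (not_le.2 ((csInf_le' hc).trans_lt c.2))

variable {X : Type*} [NormedAddCommGroup X] [NormedSpace ℝ X]

/-- Bounded sets of functionals on an Asplund space have slices of arbitrarily small diameter. -/
theorem IsAsplund.exists_slice (hX : IsAsplund X) {A : Set (StrongDual ℝ X)} (hA : A.Nonempty)
    {r : ℝ} (hr : ∀ p ∈ A, ‖p‖ ≤ r) {ε : ℝ} (hε : 0 < ε) :
    ∃ (x : X) (a : ℝ) (p : StrongDual ℝ X), (∃ q ∈ A, a < q x) ∧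
      ∀ q ∈ A, a < q x → ‖q - p‖ ≤ ε := by
  have : Nonempty A := hA.to_subtype
  let f : X → ℝ := fun x => ⨆ q : A, q.1 x
  have hb : ∀ x (q : A), q.1 x ≤ r * ‖x‖ := fun x q =>
    (le_abs_self _).trans (q.1.le_of_opNorm_le (hr _ q.2) x)
  have hbdd : ∀ x, BddAbove (range fun q : A => q.1 x) := fun x =>
    ⟨r * ‖x‖, by rintro _ ⟨q, rfl⟩; exact hb x q⟩
  have hle : ∀ x (q : A), q.1 x ≤ f x := fun x q => le_ciSup (hbdd x) q
  have hconv : ConvexOn ℝ univ f := by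
    refine ⟨convex_univ, fun x _ y _ a b ha hb _ => ciSup_le fun q => ?_⟩
    rw [map_add, map_smul, map_smul]
    exact add_le_add (mul_le_mul_of_nonneg_left (hle x q) ha)
      (mul_le_mul_of_nonneg_left (hle y q) hb)
  have hlip : ∀ x y, f x ≤ f y + r * ‖x - y‖ := fun x y => ciSup_le fun q => by
    have h1 := hle y q
    have h2 := hb (x - y) q
    rw [map_sub] at h2
    linarith
  have hr0 : 0 ≤ r := (norm_nonneg _).trans (hr _ hA.some_mem)
  have hcont : Continuous f := by
    refine (LipschitzWith.of_le_add_mul ⟨r, hr0⟩ fun x y => ?_).continuous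
    rw [dist_eq_norm]
    exact hlip x y
  obtain ⟨x, hx⟩ := hX f hconv hcont
  set p := fderiv ℝ f x
  have hε3 : 0 < ε / 3 := by positivity
  have hd := (hasFDerivAt_iff_isLittleO_nhds_zero.1 hx.hasFDerivAt).def hε3
  obtain ⟨δ, hδ, hd⟩ := Metric.eventually_nhds_iff_ball.1 hd
  refine ⟨x, f x - ε / 3 * (δ / 2), p, ?_, fun q hq hqx => ?_⟩
  · obtain ⟨q, hq⟩ := exists_lt_of_lt_ciSup (show f x - ε / 3 * (δ / 2) < f x by
      have : 0 < ε / 3 * (δ / 2) := by positivity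
      linarith)
    exact ⟨q.1, q.2, hq⟩
  · have key : ∀ h : X, ‖h‖ = δ / 2 → (q - p) h ≤ ε * ‖h‖ := by
      intro h hh
      have h1 := hd h (by rw [mem_ball_zero_iff, hh]; linarith)
      rw [Real.norm_eq_abs] at h1
      have h2 := (abs_le.1 h1).2
      have h3 := hle (x + h) ⟨q, hq⟩
      simp only [map_add] at h3
      rw [_root_.sub_apply]
      have h4 : 0 ≤ ε / 3 * ‖h‖ := by positivity
      rw [← hh] at hqx
      linarith
    refine ContinuousLinearMap.opNorm_le_of_shell (half_pos hδ) hε.le (c := (2 : ℝ)) (by norm_num)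
      fun h h1 h2 => ?_
    have hpos : 0 < ‖h‖ := lt_of_lt_of_le (by rw [Real.norm_ofNat]; positivity) h1
    have hk : ∀ g : X, ‖g‖ = ‖h‖ → (q - p) g ≤ ε * ‖g‖ := fun g hg => by
      have := key ((δ / 2 / ‖h‖) • g) (by
        rw [norm_smul, hg, Real.norm_of_nonneg (by positivity)]; field_simp)
      rw [map_smul, norm_smul, Real.norm_of_nonneg (by positivity), smul_eq_mul] at this
      have hc : 0 < δ / 2 / ‖h‖ := by positivity
      nlinarith
    rw [Real.norm_eq_abs, abs_le]
    refine ⟨?_, hk h rfl⟩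
    have := hk (-h) (norm_neg h)
    rw [map_neg, norm_neg] at this
    linarith

/-- On an Asplund space, finitely many rational constraints on a functional of norm at most `1`
determine a functional in such a way that, for every set `C`, the functionals determined by
constraints at points of `C` are `ε`-close to the unit ball of the dual, modulo vanishing on `C`. -/
theorem IsAsplund.exists_approx (hX : IsAsplund X) {ε : ℝ} (hε : 0 < ε) :
    ∃ y : Finset (X × ℚ × ℚ) → StrongDual ℝ X, ∀ (C : Set X) (φ : StrongDual ℝ X), ‖φ‖ ≤ 1 →
      ∃ F : Finset (X × ℚ × ℚ), (∀ t ∈ F, t.1 ∈ C) ∧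
        ∃ q : StrongDual ℝ X, (∀ x ∈ C, q x = φ x) ∧ ‖q - y F‖ ≤ ε := by
  classical
  let B : Set (WeakDual ℝ X) :=
    WeakDual.toStrongDual ⁻¹' Metric.closedBall (0 : StrongDual ℝ X) 1
  have : CompactSpace B := isCompact_iff_compactSpace.1 (WeakDual.isCompact_closedBall 0 1)
  have hev : ∀ x : X, Continuous fun q : B => (WeakDual.toStrongDual q.1) x := fun x =>
    (WeakDual.eval_continuous x).comp continuous_subtype_val
  let S : StrongDual ℝ X → Set B := fun e => {q | ‖WeakDual.toStrongDual q.1 - e‖ ≤ ε}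
  obtain ⟨y, hy⟩ := exists_selection_of_fragmented S fun F _ hF => by
    obtain ⟨x, a, p, ⟨q, ⟨q', hq', rfl⟩, hq⟩, hp⟩ := hX.exists_slice
      (A := (fun q : B => WeakDual.toStrongDual q.1) '' F) (hF.image _) (r := 1)
      (by rintro _ ⟨q, -, rfl⟩; exact mem_closedBall_zero_iff.1 q.2) hε
    exact ⟨{q | a < (WeakDual.toStrongDual q.1) x}, isOpen_lt continuous_const (hev x), p,
      ⟨q', hq', hq⟩, fun r hr => hp _ ⟨r, hr.1, rfl⟩ hr.2⟩
  let N : Finset (X × ℚ × ℚ) → Set B := fun F =>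
    {q | ∀ t ∈ F, (WeakDual.toStrongDual q.1) t.1 ∈ Icc (t.2.1 : ℝ) t.2.2}
  refine ⟨fun F => y (N F), fun C φ hφ => ?_⟩
  let I := {F : Finset (X × ℚ × ℚ) // ∀ t ∈ F, t.1 ∈ C ∧ φ t.1 ∈ Icc (t.2.1 : ℝ) t.2.2}
  have : Nonempty I := ⟨⟨∅, by simp⟩⟩
  obtain ⟨⟨F, hF⟩, q, hq, hqF⟩ := hy I (fun F => N F.1)
    (fun F G => ⟨⟨F.1 ∪ G.1, fun t ht => (Finset.mem_union.1 ht).elim (F.2 t) (G.2 t)⟩,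
      fun q hq t ht => hq t (Finset.mem_union_left _ ht),
      fun q hq t ht => hq t (Finset.mem_union_right _ ht)⟩)
    (fun F => by
      simp only [N, ofPred_forall]
      exact isClosed_iInter fun t => isClosed_iInter fun _ => isClosed_Icc.preimage (hev t.1))
    ⟨⟨StrongDual.toWeakDual φ, by simpa [B] using hφ⟩,
      mem_iInter.2 fun F t ht => by simpa using (F.2 t ht).2⟩
  refine ⟨F, fun t ht => (hF t ht).1, WeakDual.toStrongDual q.1, fun x hx => ?_, hqF⟩
  have hmem : ∀ a b : ℚ, (a : ℝ) ≤ φ x → φ x ≤ b →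
      (WeakDual.toStrongDual q.1) x ∈ Icc (a : ℝ) b := fun a b ha hb =>
    mem_iInter.1 hq ⟨{(x, a, b)}, by simpa using ⟨hx, ha, hb⟩⟩ (x, a, b) (by simp)
  obtain ⟨a₀, ha₀⟩ := exists_rat_lt (φ x)
  obtain ⟨b₀, hb₀⟩ := exists_rat_gt (φ x)
  exact le_antisymm
    (le_of_forall_lt_rat_imp_le fun b hb => (hmem a₀ b ha₀.le hb.le).2)
    (le_of_forall_rat_lt_imp_le fun a ha => (hmem a b₀ ha.le hb₀.le).1)

/-- The countable families of functionals produced from the maps of `IsAsplund.exists_approx`. -/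
def approxSet (y : ℕ → Finset (X × ℚ × ℚ) → StrongDual ℝ X) (C : Set X) :
    Set (StrongDual ℝ X) :=
  {z | ∃ (k m : ℕ) (F : Finset (X × ℚ × ℚ)), (∀ t ∈ F, t.1 ∈ C) ∧ z = (k : ℝ) • y m F}

theorem countable_approxSet (y : ℕ → Finset (X × ℚ × ℚ) → StrongDual ℝ X) {C : Set X}
    (hC : C.Countable) : (approxSet y C).Countable := by
  have h : {F : Finset (X × ℚ × ℚ) | ↑F ⊆ C ×ˢ (univ : Set (ℚ × ℚ))}.Countable :=
    ((countable_ofPred_finite_subset (hC.prod countable_univ)).preimage Finset.coe_injective).mono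
      fun (F : Finset (X × ℚ × ℚ)) hF => show _ ∧ _ from ⟨F.finite_toSet, hF⟩
  refine (((countable_univ (α := ℕ)).prod ((countable_univ (α := ℕ)).prod h)).image
    fun t => (t.1 : ℝ) • y t.2.1 t.2.2).mono ?_
  rintro _ ⟨k, m, F, hF, rfl⟩
  exact ⟨(k, m, F), ⟨trivial, trivial, fun t ht => ⟨hF t ht, trivial⟩⟩, rfl⟩

theorem approxSet_iUnion (y : ℕ → Finset (X × ℚ × ℚ) → StrongDual ℝ X) {ι : Type*} [Nonempty ι]
    {C : ι → Set X} (hC : Directed (· ⊆ ·) C) :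
    approxSet y (⋃ i, C i) = ⋃ i, approxSet y (C i) := by
  ext z
  simp only [mem_iUnion, approxSet, mem_ofPred_eq]
  constructor
  · rintro ⟨k, m, F, hF, rfl⟩
    have hsub : (↑F : Set (X × ℚ × ℚ)) ⊆ ⋃ i, Prod.fst ⁻¹' C i := fun t ht =>
      mem_iUnion.2 (hF t ht)
    have hdir : Directed (· ⊆ ·) fun i => (Prod.fst ⁻¹' C i : Set (X × ℚ × ℚ)) := fun i j =>
      (hC i j).imp fun _ h => ⟨preimage_mono h.1, preimage_mono h.2⟩
    obtain ⟨i, hi⟩ := hdir.exists_mem_subset_of_finset_subset_biUnion hsub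
    exact ⟨i, k, m, F, hi, rfl⟩
  · rintro ⟨i, k, m, F, hF, rfl⟩
    exact ⟨k, m, F, fun t ht => ⟨i, hF t ht⟩, rfl⟩

/-- Point-finite open covers, indexed by the centres of balls of radius `1 / (n + 1)` that contain
their members. -/
theorem exists_pointFinite_covers (X : Type*) [PseudoMetricSpace X] :
    ∃ v : ℕ → X → Set X, (∀ n x, IsOpen (v n x)) ∧
    (∀ n z, ∃ x, z ∈ v n x) ∧ (∀ n z, {x | z ∈ v n x}.Finite) ∧
    ∀ n x, v n x ⊆ Metric.ball x (1 / (n + 1)) := by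
  have h : ∀ n : ℕ, ∃ v : X → Set X, (∀ x, IsOpen (v x)) ∧ (∀ z, ∃ x, z ∈ v x) ∧
      (∀ z, {x | z ∈ v x}.Finite) ∧ ∀ x, v x ⊆ Metric.ball x (1 / (n + 1)) := fun n => by
    obtain ⟨v, h1, h2, h3, h4⟩ := precise_refinement
      (fun x : X => Metric.ball x (1 / (n + 1 : ℝ))) (fun x => Metric.isOpen_ball)
      (eq_univ_of_forall fun z => mem_iUnion.2 ⟨z, Metric.mem_ball_self (by positivity)⟩)
    exact ⟨v, h1, fun z => mem_iUnion.1 (h2.symm ▸ mem_univ z), h3.point_finite, h4⟩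
  choose v h1 h2 h3 h4 using h
  exact ⟨v, h1, h2, h3, h4⟩

/-- The indices of the members of the covers `v n` that meet the span of `C`. -/
def indicesMeeting (v : ℕ → X → Set X) (C : Set X) : Set X :=
  {x | ∃ n, (v n x ∩ Submodule.span ℝ C).Nonempty}

theorem countable_indicesMeeting {v : ℕ → X → Set X} (ho : ∀ n x, IsOpen (v n x))
    (hf : ∀ n z, {x | z ∈ v n x}.Finite) {C : Set X} (hC : C.Countable) :
    (indicesMeeting v C).Countable := by
  obtain ⟨D, hDs, hD, hDd⟩ := hC.isSeparable.span (R := ℝ) |>.exists_countable_dense_subset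
  refine (countable_iUnion fun n => hD.biUnion fun z _ => (hf n z).countable).mono ?_
  rintro x ⟨n, z, hz, hzC⟩
  obtain ⟨d, hd, hdD⟩ := mem_closure_iff.1 (hDd hzC) _ (ho n x) hz
  exact mem_iUnion.2 ⟨n, mem_iUnion₂.2 ⟨d, hdD, hd⟩⟩

theorem indicesMeeting_congr {v : ℕ → X → Set X} (ho : ∀ n x, IsOpen (v n x)) {C₁ C₂ : Set X}
    (h : closedSpan C₁ = closedSpan C₂) : indicesMeeting v C₁ = indicesMeeting v C₂ := by
  have key : ∀ C : Set X, indicesMeeting v C = {x | ∃ n, (v n x ∩ closedSpan C).Nonempty} :=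
    fun C => by
      ext x
      refine exists_congr fun n => ?_
      rw [closedSpan, Submodule.topologicalClosure_coe, inter_comm, inter_comm _ (closure _),
        closure_inter_open_nonempty_iff (ho n x)]
  rw [key, key, h]

theorem indicesMeeting_iUnion (v : ℕ → X → Set X) {ι : Type*} [Nonempty ι] {C : ι → Set X}
    (hC : Directed (· ⊆ ·) C) : indicesMeeting v (⋃ i, C i) = ⋃ i, indicesMeeting v (C i) := by
  have h : (Submodule.span ℝ (⋃ i, C i) : Set X) = ⋃ i, (Submodule.span ℝ (C i) : Set X) := by
    rw [Submodule.span_iUnion, Submodule.coe_iSup_of_directed]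
    exact fun i j => (hC i j).imp fun _ h => ⟨Submodule.span_mono h.1, Submodule.span_mono h.2⟩
  ext x
  simp only [indicesMeeting, h, inter_iUnion, nonempty_iUnion, mem_ofPred_eq, mem_iUnion]
  exact exists_comm

theorem directed_indicesMeeting (v : ℕ → X → Set X) {ι : Type*} {C : ι → Set X}
    (hC : Directed (· ⊆ ·) C) : Directed (· ⊆ ·) fun i => indicesMeeting v (C i) :=
  fun i j => (hC i j).imp fun _ h =>
    ⟨fun _ ⟨n, z, hz, hz'⟩ => ⟨n, z, hz, Submodule.span_mono h.1 hz'⟩,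
      fun _ ⟨n, z, hz, hz'⟩ => ⟨n, z, hz, Submodule.span_mono h.2 hz'⟩⟩

theorem approxSet_indicesMeeting_iUnion (y : ℕ → Finset (X × ℚ × ℚ) → StrongDual ℝ X)
    (v : ℕ → X → Set X) {ι : Type*} [Nonempty ι] {C : ι → Set X} (hC : Directed (· ⊆ ·) C) :
    approxSet y (indicesMeeting v (⋃ i, C i)) = ⋃ i, approxSet y (indicesMeeting v (C i)) := by
  rw [indicesMeeting_iUnion v hC, approxSet_iUnion y (directed_indicesMeeting v hC)]

theorem closedSpan_subset_closure_indicesMeeting {v : ℕ → X → Set X}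
    (hc : ∀ n z, ∃ x, z ∈ v n x)
    (hb : ∀ n x, v n x ⊆ Metric.ball x (1 / (n + 1))) (C : Set X) :
    (closedSpan C : Set X) ⊆ closure (indicesMeeting v C) := by
  rw [closedSpan, Submodule.topologicalClosure_coe]
  refine closure_minimal (fun z hz => Metric.mem_closure_iff.2 fun ε hε => ?_) isClosed_closure
  obtain ⟨n, hn⟩ := exists_nat_one_div_lt hε
  obtain ⟨x, hx⟩ := hc n z
  exact ⟨x, ⟨n, z, hx, hz⟩, (Metric.mem_ball.1 (hb n x hx)).trans hn⟩

theorem IsAsplund.exists_isAsplundGenerator (hX : IsAsplund X) :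
    ∃ G : CountableSubset X → CountableSubset (StrongDual ℝ X), IsAsplundGenerator G := by
  choose y hy using fun m : ℕ => hX.exists_approx (Nat.one_div_pos_of_nat (α := ℝ) (n := m))
  obtain ⟨v, ho, hc, hf, hb⟩ := exists_pointFinite_covers X
  have key : ∀ (C : Set X) (φ : StrongDual ℝ X) (ε : ℝ), 0 < ε →
      ∃ z ∈ approxSet y (indicesMeeting v C), ∀ x ∈ closedSpan C, |φ x - z x| ≤ ε * ‖x‖ := by
    intro C φ ε hε
    obtain ⟨k, hk⟩ := exists_nat_gt ‖φ‖
    have hk0 : (0 : ℝ) < k := (norm_nonneg _).trans_lt hk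
    obtain ⟨m, hm⟩ := exists_nat_one_div_lt (show 0 < ε / k by positivity)
    obtain ⟨F, hF, q, hq, hqF⟩ := hy m (indicesMeeting v C) ((k : ℝ)⁻¹ • φ) (by
      rw [norm_smul, norm_inv, Real.norm_of_nonneg hk0.le, inv_mul_le_one₀ hk0]
      exact hk.le)
    refine ⟨(k : ℝ) • y m F, ⟨k, m, F, hF, rfl⟩, fun x hx => ?_⟩
    have heq : q x = (k : ℝ)⁻¹ * φ x := by
      have hcl : IsClosed {x | q x = ((k : ℝ)⁻¹ • φ) x} :=
        isClosed_eq q.continuous (ContinuousLinearMap.continuous _)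
      exact closure_minimal hq hcl (closedSpan_subset_closure_indicesMeeting hc hb C hx)
    have h1 : φ x - ((k : ℝ) • y m F) x = k * (q - y m F) x := by
      rw [_root_.sub_apply, heq, _root_.smul_apply, smul_eq_mul]
      field_simp
    have h2 := (q - y m F).le_of_opNorm_le (hqF.trans hm.le) x
    rw [Real.norm_eq_abs] at h2
    rw [h1, abs_mul, abs_of_pos hk0]
    calc (k : ℝ) * |(q - y m F) x| ≤ k * (ε / k * ‖x‖) := by gcongr
      _ = ε * ‖x‖ := by field_simp
  refine ⟨fun C => ⟨approxSet y (indicesMeeting v C.1),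
    countable_approxSet y (countable_indicesMeeting ho hf C.2)⟩, ⟨fun C => ?_, fun C hC => ?_, ?_,
    fun C₁ C₂ h => ?_⟩⟩
  · intro ψ
    refine (Metric.mem_closure_iff (α := StrongDual ℝ (closedSpan C.1))).2 fun r hr => ?_
    obtain ⟨φ, hφ, -⟩ := exists_extension_norm_eq (closedSpan C.1) ψ
    obtain ⟨z, hz, hzφ⟩ := key C.1 φ (r / 2) (half_pos hr)
    refine ⟨restrict (closedSpan C.1) z, mem_image_of_mem _ hz, ?_⟩
    refine (dist_eq_norm ψ (restrict (closedSpan C.1) z)).trans_lt ?_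
    refine (ContinuousLinearMap.opNorm_le_bound _ (half_pos hr).le fun x => ?_).trans_lt
      (half_lt_self hr)
    have := hzφ x x.2
    rwa [hφ] at this
  · exact approxSet_indicesMeeting_iUnion y v (C := fun n => (C n).1) (Monotone.directed_le hC)
  · have hdir : Directed (· ⊆ ·) fun C : CountableSubset X => C.1 := fun C D =>
      ⟨⟨C.1 ∪ D.1, C.2.union D.2⟩, subset_union_left, subset_union_right⟩
    have huniv : (⋃ C : CountableSubset X, C.1) = univ := eq_univ_of_forall fun x =>
      mem_iUnion.2 ⟨⟨{x}, countable_singleton x⟩, mem_singleton x⟩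
    have : Nonempty (CountableSubset X) := ⟨⟨∅, countable_empty⟩⟩
    refine Metric.dense_iff.2 fun φ r hr => ?_
    obtain ⟨z, hz, hzφ⟩ := key univ φ (r / 2) (half_pos hr)
    rw [← huniv, approxSet_indicesMeeting_iUnion y v hdir] at hz
    refine ⟨z, ?_, hz⟩
    rw [Metric.mem_ball, dist_comm, dist_eq_norm]
    refine (ContinuousLinearMap.opNorm_le_bound _ (half_pos hr).le fun x => ?_).trans_lt
      (half_lt_self hr)
    exact hzφ x (subset_closure (Submodule.subset_span trivial))
  · dsimp only
    rw [indicesMeeting_congr ho h]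

/-- The sequence obtained from `C` by repeatedly adjoining the values of `Φ`. -/
def adjoinSeq {Z : Type*} (Φ : CountableSubset Z → CountableSubset Z) (C : CountableSubset Z) :
    ℕ → CountableSubset Z
  | 0 => C
  | n + 1 => ⟨(adjoinSeq Φ C n).1 ∪ (Φ (adjoinSeq Φ C n)).1,
      (adjoinSeq Φ C n).2.union (Φ (adjoinSeq Φ C n)).2⟩

theorem monotone_adjoinSeq {Z : Type*} (Φ : CountableSubset Z → CountableSubset Z)
    (C : CountableSubset Z) :
    Monotone (adjoinSeq Φ C) :=
  monotone_nat_of_le_succ fun _ => subset_union_left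

section closedSpan

variable {Z : Type*} [NormedAddCommGroup Z] [NormedSpace ℝ Z]

theorem subset_closedSpan (A : Set Z) : A ⊆ closedSpan A :=
  Submodule.subset_span.trans subset_closure

theorem isClosed_closedSpan (A : Set Z) : IsClosed (closedSpan A : Set Z) :=
  Submodule.isClosed_topologicalClosure _

theorem closedSpan_le {A : Set Z} {V : Submodule ℝ Z} (hV : IsClosed (V : Set Z)) (h : A ⊆ V) :
    closedSpan A ≤ V :=
  Submodule.topologicalClosure_minimal _ (Submodule.span_le.2 h) hV

theorem closedSpan_mono {A B : Set Z} (h : A ⊆ B) : closedSpan A ≤ closedSpan B :=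
  closedSpan_le (isClosed_closedSpan B) (h.trans (subset_closedSpan B))

/-- The closed span of a countable set, as a separable closed subspace. -/
def sepSpan (C : CountableSubset Z) : SepSubspace Z :=
  ⟨closedSpan C.1, isClosed_closedSpan _, (C.2.isSeparable.span (R := ℝ)).closure⟩

end closedSpan

theorem norm_restrict_le (V : Submodule ℝ X) (y : StrongDual ℝ X) : ‖restrict V y‖ ≤ ‖y‖ :=
  ContinuousLinearMap.opNorm_le_bound _ (norm_nonneg y) fun x => y.le_opNorm x

theorem norm_restrict_mono {V W : Submodule ℝ X} (h : V ≤ W) (y : StrongDual ℝ X) :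
    ‖restrict V y‖ ≤ ‖restrict W y‖ :=
  ContinuousLinearMap.opNorm_le_bound _ (norm_nonneg (restrict W y)) fun x =>
    (restrict W y).le_opNorm ⟨x.1, h x.2⟩

theorem continuous_restrict (V : Submodule ℝ X) : Continuous (restrict V) := by
  unfold restrict
  fun_prop

theorem isClosed_norm_le_norm_restrict (V : Submodule ℝ X) :
    IsClosed {y : StrongDual ℝ X | ‖y‖ ≤ ‖restrict V y‖} :=
  isClosed_le continuous_norm
    ((continuous_norm (E := StrongDual ℝ V)).comp (continuous_restrict V))

/-- A separable set of functionals is normed by a countable set of vectors. -/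
theorem exists_countable_norming {Y : Set (StrongDual ℝ X)}
    (hY : TopologicalSpace.IsSeparable Y) : ∃ C : CountableSubset X,
      ∀ V : Submodule ℝ X, C.1 ⊆ V → ∀ y ∈ Y, ‖y‖ ≤ ‖restrict V y‖ := by
  obtain ⟨D, -, hD, hDY⟩ := hY.exists_countable_dense_subset
  have h : ∀ (d : StrongDual ℝ X) (n : ℕ), ∃ x : X, ‖x‖ < 1 ∧ ‖d‖ - 1 / (n + 1) < ‖d x‖ :=
    fun d n => d.exists_lt_apply_of_lt_opNorm (sub_lt_self _ Nat.one_div_pos_of_nat)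
  choose x hx1 hx using h
  refine ⟨⟨⋃ d ∈ D, range (x d), hD.biUnion fun d _ => countable_range _⟩, fun V hV y hy => ?_⟩
  refine closure_minimal (fun d hd => ?_) (isClosed_norm_le_norm_restrict V) (hDY hy)
  refine le_of_forall_pos_lt_add (α := ℝ) fun ε hε => ?_
  obtain ⟨n, hn⟩ := exists_nat_one_div_lt hε
  have hmem : x d n ∈ V := hV (mem_iUnion₂.2 ⟨d, hd, mem_range_self n⟩)
  have h1 : ‖d (x d n)‖ ≤ ‖restrict V d‖ * ‖x d n‖ :=
    (restrict V d).le_opNorm ⟨x d n, hmem⟩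
  have h2 : ‖restrict V d‖ * ‖x d n‖ ≤ ‖restrict V d‖ :=
    mul_le_of_le_one_right (norm_nonneg (restrict V d)) (hx1 d n).le
  linarith [hx d n]

namespace IsAsplundGenerator

variable {G : CountableSubset X → CountableSubset (StrongDual ℝ X)} (hG : IsAsplundGenerator G)
include hG

theorem mono {C D : CountableSubset X} (h : C ≤ D) : (G C).1 ⊆ (G D).1 := by
  let s : ℕ → CountableSubset X := fun n => Nat.casesOn n C fun _ => D
  have hs : Monotone s := monotone_nat_of_le_succ fun n => by cases n; exacts [h, le_rfl]
  have hD : CountableSubset.iUnion s = D :=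
    Subtype.ext (subset_antisymm (iUnion_subset fun n => by cases n; exacts [h, subset_rfl])
      (subset_iUnion (fun n => (s n).1) 1))
  have := hG.iUnion_eq s hs
  rw [hD] at this
  rw [this]
  exact subset_iUnion (fun n => (G (s n)).1) 0

theorem closedSpan_le_closedSpan {C D : CountableSubset X} (h : closedSpan C.1 ≤ closedSpan D.1) :
    closedSpan (G C).1 ≤ closedSpan (G D).1 := by
  let E : CountableSubset X := ⟨C.1 ∪ D.1, C.2.union D.2⟩
  have hE : closedSpan E.1 = closedSpan D.1 :=
    le_antisymm (closedSpan_le (isClosed_closedSpan _)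
      (union_subset ((subset_closedSpan _).trans h) (subset_closedSpan _)))
      (closedSpan_mono subset_union_right)
  rw [← hG.closedSpan_congr E D hE]
  exact closedSpan_mono (hG.mono (show C ≤ E from subset_union_left))

theorem norm_le_norm_restrict_iUnion {C : ℕ → CountableSubset X} (hC : Monotone C)
    (h : ∀ n, ∀ y ∈ closedSpan (G (C n)).1, ‖y‖ ≤ ‖restrict (closedSpan (C (n + 1)).1) y‖) :
    ∀ y ∈ closedSpan (G (CountableSubset.iUnion C)).1,
      ‖y‖ ≤ ‖restrict (closedSpan (CountableSubset.iUnion C).1) y‖ := by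
  refine fun y hy => closure_minimal (fun z hz => ?_) (isClosed_norm_le_norm_restrict _) hy
  have hz' : z ∈ ⨆ n, Submodule.span ℝ (G (C n)).1 := by
    rw [← Submodule.span_iUnion, ← hG.iUnion_eq C hC]
    exact hz
  obtain ⟨n, hn⟩ := (Submodule.mem_iSup_of_directed _ (Monotone.directed_le fun m n hmn =>
    Submodule.span_mono (hG.mono (hC hmn)))).1 hz'
  exact (h n z (subset_closure hn)).trans
    (norm_restrict_mono (closedSpan_mono (subset_iUnion (fun n => (C n).1) (n + 1))) z)

/-- If the closed span of `C` norms that of `G C`, then restriction to the former maps the latter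
isometrically onto its dual. -/
theorem isometry_and_surjective [CompleteSpace X] {C : CountableSubset X}
    (h : ∀ y ∈ closedSpan (G C).1, ‖y‖ ≤ ‖restrict (closedSpan C.1) y‖) :
    Isometry (Rectangle.restrict ((sepSpan C, sepSpan (G C)) : Rectangle X)) ∧
      Function.Surjective (Rectangle.restrict ((sepSpan C, sepSpan (G C)) : Rectangle X)) := by
  have hiso : Isometry (Rectangle.restrict ((sepSpan C, sepSpan (G C)) : Rectangle X)) := by
    refine Isometry.of_dist_eq fun y z => ?_
    rw [dist_eq_norm, dist_eq_norm]
    exact le_antisymm (norm_restrict_le (closedSpan C.1) (y.1 - z.1)) (h _ (y - z).2)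
  refine ⟨hiso, ?_⟩
  have : CompleteSpace (sepSpan (G C)).1 := (sepSpan (G C)).2.1.completeSpace_coe
  have hcl := hiso.isClosedEmbedding.isClosed_range
  refine fun ψ => closure_minimal ?_ hcl (hG.dense_restrict C ψ)
  rintro _ ⟨y, hy, rfl⟩
  exact ⟨⟨y, subset_closedSpan _ hy⟩, rfl⟩

theorem exists_le (V : SepSubspace X) (Y : SepSubspace (StrongDual ℝ X)) :
    ∃ C : CountableSubset X, V ≤ sepSpan C ∧ Y ≤ sepSpan (G C) ∧
      ∀ y ∈ closedSpan (G C).1, ‖y‖ ≤ ‖restrict (closedSpan C.1) y‖ := by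
  obtain ⟨A, -, hA, hAV⟩ := V.2.2.exists_countable_dense_subset
  obtain ⟨D, -, hD, hDY⟩ := Y.2.2.exists_countable_dense_subset
  have h : ∀ (d : StrongDual ℝ X) (n : ℕ), ∃ (C : CountableSubset X), ∃ z ∈ (G C).1,
      dist d z < 1 / (n + 1) := fun d n => by
    obtain ⟨z, hz, hdz⟩ := Metric.mem_closure_iff.1 (hG.dense_iUnion d) (1 / (n + 1))
      Nat.one_div_pos_of_nat
    obtain ⟨C, hC⟩ := mem_iUnion.1 hz
    exact ⟨C, z, hC, hdz⟩
  choose B hB using h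
  choose N hN using fun C : CountableSubset X => exists_countable_norming (sepSpan (G C)).2.2
  let C₀ : CountableSubset X := ⟨A ∪ ⋃ d ∈ D, ⋃ n, (B d n).1,
    hA.union (hD.biUnion fun d _ => countable_iUnion fun n => (B d n).2)⟩
  have hmono := monotone_adjoinSeq N C₀
  have hle : C₀ ≤ CountableSubset.iUnion (adjoinSeq N C₀) :=
    subset_iUnion (fun n => (adjoinSeq N C₀ n).1) 0
  refine ⟨CountableSubset.iUnion (adjoinSeq N C₀), ?_, ?_,
    hG.norm_le_norm_restrict_iUnion hmono fun n => hN _ _ ?_⟩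
  · exact hAV.trans (closure_minimal ((subset_union_left.trans hle).trans (subset_closedSpan _))
      (isClosed_closedSpan _))
  · refine hDY.trans (closure_minimal (fun d hd => ?_) (isClosed_closedSpan _))
    refine (isClosed_closedSpan _).closure_subset (Metric.mem_closure_iff.2 fun ε hε => ?_)
    obtain ⟨n, hn⟩ := exists_nat_one_div_lt hε
    obtain ⟨z, hz, hdz⟩ := hB d n
    have hBle : B d n ≤ C₀ := fun x hx =>
      Or.inr (mem_iUnion₂.2 ⟨d, hd, mem_iUnion.2 ⟨n, hx⟩⟩)
    exact ⟨z, subset_closedSpan _ (hG.mono (hBle.trans hle) hz), hdz.trans hn⟩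
  · exact subset_union_right.trans (subset_closedSpan _)

theorem exists_rich [CompleteSpace X] : ∃ A : Set (Rectangle X), Rich A ∧
    (∀ R₁ ∈ A, ∀ R₂ ∈ A, R₁.1 ≤ R₂.1 → R₁.2 ≤ R₂.2) ∧
    (∀ R ∈ A, Isometry (Rectangle.restrict R) ∧ Function.Surjective (Rectangle.restrict R)) := by
  refine ⟨{R | ∃ C : CountableSubset X, R = (sepSpan C, sepSpan (G C)) ∧
    ∀ y ∈ closedSpan (G C).1, ‖y‖ ≤ ‖restrict (closedSpan C.1) y‖}, ⟨?_, ?_⟩, ?_, ?_⟩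
  · rintro ⟨V, Y⟩
    obtain ⟨C, hV, hY, hC⟩ := hG.exists_le V Y
    exact ⟨_, ⟨C, rfl, hC⟩, hV, hY⟩
  · intro r hr hrA
    choose C hC hCn using hrA
    have hCle : ∀ {m n}, m ≤ n → closedSpan (C m).1 ≤ closedSpan (C n).1 := fun {m n} hmn => by
      have := (hr hmn).1
      rwa [hC, hC] at this
    let D : ℕ → CountableSubset X := fun n =>
      ⟨⋃ k ≤ n, (C k).1, (Set.to_countable _).biUnion fun k _ => (C k).2⟩
    have hD : Monotone D := fun m n hmn => biUnion_subset_biUnion_left fun k hk => le_trans hk hmn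
    have hDC : ∀ n, closedSpan (D n).1 = closedSpan (C n).1 := fun n =>
      le_antisymm (closedSpan_le (isClosed_closedSpan _)
        (iUnion₂_subset fun k hk => (subset_closedSpan _).trans (hCle hk)))
        (closedSpan_mono (subset_iUnion₂_of_subset n le_rfl subset_rfl))
    have hr' : ∀ n, r n = (sepSpan (D n), sepSpan (G (D n))) := fun n => by
      rw [hC n]
      exact Prod.ext (Subtype.ext (hDC n).symm)
        (Subtype.ext (hG.closedSpan_congr _ _ (hDC n).symm))
    have hUD : ∀ n, D n ≤ CountableSubset.iUnion D := fun n => subset_iUnion (fun n => (D n).1) n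
    refine ⟨_, ⟨CountableSubset.iUnion D, rfl, hG.norm_le_norm_restrict_iUnion hD
      fun n y hy => ?_⟩, ?_, ?_⟩
    · rw [hG.closedSpan_congr _ _ (hDC n)] at hy
      refine (hCn n y hy).trans (norm_restrict_mono ?_ y)
      rw [hDC]
      exact hCle n.le_succ
    · rintro _ ⟨n, rfl⟩
      rw [hr']
      exact ⟨closedSpan_mono (hUD n), closedSpan_mono (hG.mono (hUD n))⟩
    · intro t ht
      have htn : ∀ n, closedSpan (D n).1 ≤ t.1.1 ∧ closedSpan (G (D n)).1 ≤ t.2.1 := fun n => by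
        have := ht (mem_range_self n)
        rw [hr'] at this
        exact this
      refine ⟨closedSpan_le t.1.2.1 (iUnion_subset fun n =>
        (subset_closedSpan _).trans (htn n).1), closedSpan_le t.2.2.1 ?_⟩
      rw [hG.iUnion_eq D hD]
      exact iUnion_subset fun n => (subset_closedSpan _).trans (htn n).2
  · rintro _ ⟨C, rfl, -⟩ _ ⟨D, rfl, -⟩ h
    exact hG.closedSpan_le_closedSpan h
  · rintro _ ⟨C, rfl, hC⟩
    exact hG.isometry_and_surjective hC

end IsAsplundGenerator

/-- A continuous convex function has a subgradient at every point. -/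
theorem exists_subgradient {f : X → ℝ} (hf : ConvexOn ℝ univ f) (hc : Continuous f) (x : X) :
    ∃ p : StrongDual ℝ X, ∀ y, f x + p (y - x) ≤ f y := by
  obtain ⟨g, hg⟩ := geometric_hahn_banach_open_point
    (s := {z : X × ℝ | z.1 ∈ univ ∧ f z.1 < z.2}) (x := (x, f x)) hf.convex_strict_epigraph
    (by simpa using isOpen_lt (hc.comp continuous_fst) continuous_snd) (by simp)
  set c := g (0, 1) with hcdef
  have hsplit : ∀ z t, g (z, t) = g (z, 0) + t * c := fun z t => by
    have : ((z, t) : X × ℝ) = (z, 0) + t • (0, 1) := by simp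
    rw [this, map_add, map_smul, smul_eq_mul]
  have hcneg : c < 0 := by
    have := hg (x, f x + 1) ⟨trivial, by simp⟩
    rw [hsplit, hsplit x (f x)] at this
    linarith
  refine ⟨(-c)⁻¹ • g.comp (ContinuousLinearMap.inl ℝ X ℝ), fun y => ?_⟩
  refine le_of_forall_gt_imp_ge_of_dense fun t ht => ?_
  have h1 := hg (y, t) ⟨trivial, ht⟩
  rw [hsplit, hsplit x (f x)] at h1
  have h2 : g (y - x, 0) = g (y, 0) - g (x, 0) := by
    rw [← map_sub]; simp
  have h3 : (-c)⁻¹ * g (y - x, 0) ≤ t - f x := by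
    rw [inv_mul_le_iff₀ (by linarith)]
    linarith
  simpa using show f x + (-c)⁻¹ * g (y - x, 0) ≤ t by linarith

/-- The points near which the second differences of `f` are bounded by `ε` times the norm of the
increment. -/
def smallSecondDiff {X : Type*} [NormedAddCommGroup X] (f : X → ℝ) (ε : ℝ) : Set X :=
  {x | ∃ δ > 0, ∀ y ∈ Metric.ball x δ, ∀ h : X, ‖h‖ < δ →
    f (y + h) + f (y - h) - 2 * f y ≤ ε * ‖h‖}

theorem isOpen_smallSecondDiff {X : Type*} [NormedAddCommGroup X] (f : X → ℝ) (ε : ℝ) :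
    IsOpen (smallSecondDiff f ε) := by
  refine Metric.isOpen_iff.2 fun x ⟨δ, hδ, h⟩ => ⟨δ / 2, half_pos hδ, fun x' hx' =>
    ⟨δ / 2, half_pos hδ, fun y hy k hk => h y ?_ k (hk.trans (half_lt_self hδ))⟩⟩
  rw [Metric.mem_ball] at *
  linarith [dist_triangle y x' x]

theorem differentiableAt_of_smallSecondDiff {f : X → ℝ} (hf : ConvexOn ℝ univ f)
    (hc : Continuous f) {x : X} (hx : ∀ n : ℕ, x ∈ smallSecondDiff f (1 / (n + 1))) :
    DifferentiableAt ℝ f x := by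
  obtain ⟨p, hp⟩ := exists_subgradient hf hc x
  refine HasFDerivAt.differentiableAt (f' := p) (hasFDerivAt_iff_isLittleO_nhds_zero.2
    (Asymptotics.isLittleO_iff.2 fun ε hε => ?_))
  obtain ⟨n, hn⟩ := exists_nat_one_div_lt hε
  obtain ⟨δ, hδ, h⟩ := hx n
  filter_upwards [Metric.ball_mem_nhds (0 : X) hδ] with k hk
  have h1 := h x (Metric.mem_ball_self hδ) k (mem_ball_zero_iff.1 hk)
  have h2 := hp (x + k)
  have h3 := hp (x - k)
  rw [add_sub_cancel_left] at h2
  rw [sub_sub_cancel_left, map_neg] at h3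
  have h4 : 1 / ((n : ℝ) + 1) * ‖k‖ ≤ ε * ‖k‖ := by gcongr
  rw [Real.norm_eq_abs, abs_le]
  constructor <;> linarith

theorem dense_smallSecondDiff [CompleteSpace X] {f : X → ℝ} (hf : ConvexOn ℝ univ f)
    (hc : Continuous f)
    (hX : ∀ C : CountableSubset X, ∃ D : CountableSubset (StrongDual ℝ X),
      ∀ (p : StrongDual ℝ X) (ε : ℝ), 0 < ε →
        ∃ d ∈ D.1, ∀ w ∈ closedSpan C.1, |p w - d w| ≤ ε * ‖w‖) {ε : ℝ} (hε : 0 < ε) :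
    Dense (smallSecondDiff f ε) := by
  refine Metric.dense_iff.2 fun u r hr => ?_
  by_contra hcon
  have hbad : ∀ (x : X) (n : ℕ), ∃ y h : X, x ∈ Metric.ball u r →
      y ∈ Metric.ball x (1 / (n + 1)) ∧ ‖h‖ < 1 / (n + 1) ∧
        ε * ‖h‖ < f (y + h) + f (y - h) - 2 * f y := fun x n => by
    by_cases hx : x ∈ Metric.ball u r
    · by_contra! hno
      exact hcon ⟨x, hx, 1 / (n + 1), Nat.one_div_pos_of_nat, fun y hy h hh => (hno y h).2 hy hh⟩
    · exact ⟨0, 0, fun h => (hx h).elim⟩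
  choose y h hyh using hbad
  choose S hSs hS hSd using fun C : CountableSubset X =>
    (C.2.isSeparable.span (R := ℝ)).exists_countable_dense_subset
  let Φ : CountableSubset X → CountableSubset X := fun C =>
    ⟨S C ∪ ⋃ x ∈ C.1, range (y x) ∪ range (h x),
      (hS C).union (C.2.biUnion fun x _ => (countable_range _).union (countable_range _))⟩
  let s := adjoinSeq Φ ⟨{u}, countable_singleton u⟩
  have hs : Monotone s := monotone_adjoinSeq _ _
  let C := CountableSubset.iUnion s
  have hsC : ∀ n, s n ≤ C := fun n => subset_iUnion (fun n => (s n).1) n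
  have hu : u ∈ C.1 := hsC 0 rfl
  have hyhC : ∀ x ∈ C.1, ∀ n, y x n ∈ C.1 ∧ h x n ∈ C.1 := fun x hx n => by
    obtain ⟨m, hm⟩ := mem_iUnion.1 hx
    have : range (y x) ∪ range (h x) ⊆ C.1 := fun z hz =>
      hsC (m + 1) (Or.inr (Or.inr (mem_iUnion₂.2 ⟨x, hm, hz⟩)))
    exact ⟨this (Or.inl ⟨n, rfl⟩), this (Or.inr ⟨n, rfl⟩)⟩
  have hdense : (closedSpan C.1 : Set X) ⊆ closure C.1 := by
    refine closure_minimal (fun z hz => ?_) isClosed_closure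
    have hz' : z ∈ ⨆ n, Submodule.span ℝ (s n).1 := by
      rw [← Submodule.span_iUnion]; exact hz
    rw [Submodule.mem_iSup_of_directed _ (Monotone.directed_le fun m n hmn =>
      Submodule.span_mono (hs hmn))] at hz'
    obtain ⟨n, hn⟩ := hz'
    exact closure_mono (fun x hx => hsC (n + 1) (Or.inr (Or.inl hx))) (hSd (s n) hn)
  obtain ⟨D, hD⟩ := hX C
  have := D.2.to_subtype
  have : CompleteSpace (closedSpan C.1) := (isClosed_closedSpan C.1).completeSpace_coe
  let A : D.1 → Set (closedSpan C.1) := fun d =>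
    {w | ∀ z : closedSpan C.1, f w + d.1 (z - w) - ε / 2 * ‖(z : X) - w‖ ≤ f z}
  have hAcl : ∀ d, IsClosed (A d) := fun d => by
    simp only [A, ofPred_forall]
    exact isClosed_iInter fun z => isClosed_le (by fun_prop) continuous_const
  have hAU : ⋃ d, A d = univ := eq_univ_of_forall fun w => by
    obtain ⟨p, hp⟩ := exists_subgradient hf hc w
    obtain ⟨d, hd, hpd⟩ := hD p (ε / 2) (half_pos hε)
    refine mem_iUnion.2 ⟨⟨d, hd⟩, fun z => ?_⟩
    have h1 := (abs_le.1 (hpd (z - w) (sub_mem z.2 w.2))).1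
    have h2 := hp z
    linarith
  let u' : closedSpan C.1 := ⟨u, subset_closedSpan _ hu⟩
  obtain ⟨w, hwu, hw⟩ := (dense_iUnion_interior_of_closed hAcl hAU).inter_open_nonempty
    (Metric.ball u' r) Metric.isOpen_ball ⟨u', Metric.mem_ball_self hr⟩
  obtain ⟨d, hw⟩ := mem_iUnion.1 hw
  obtain ⟨ρ, hρ, hball⟩ := Metric.isOpen_iff.1 (Metric.isOpen_ball.inter isOpen_interior) w
    ⟨hwu, hw⟩
  obtain ⟨c, hcC, hcw⟩ := Metric.mem_closure_iff.1 (hdense w.2) (ρ / 3) (by positivity)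
  rw [dist_comm] at hcw
  obtain ⟨n, hn⟩ := exists_nat_one_div_lt (show 0 < ρ / 3 by positivity)
  have hcu : c ∈ Metric.ball u r :=
    (hball (show (⟨c, subset_closedSpan _ hcC⟩ : closedSpan C.1) ∈ Metric.ball w ρ from
      hcw.trans (by linarith))).1
  obtain ⟨hy, hh, hlt⟩ := hyh c n hcu
  obtain ⟨hyC, hhC⟩ := hyhC c hcC n
  let y' : closedSpan C.1 := ⟨y c n, subset_closedSpan _ hyC⟩
  let h' : closedSpan C.1 := ⟨h c n, subset_closedSpan _ hhC⟩
  have hyw : dist (y c n) w < 2 * ρ / 3 := by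
    rw [Metric.mem_ball] at hy
    linarith [dist_triangle (y c n) c w]
  have hmem : ∀ k : closedSpan C.1, ‖k‖ = ‖h'‖ → y' + k ∈ A d := fun k hk => by
    refine interior_subset (hball (show dist _ _ < _ from ?_)).2
    have h1 : dist (y' + k) y' < ρ / 3 := by
      rw [dist_eq_norm, add_sub_cancel_left, hk]
      exact hh.trans hn
    have h2 : dist y' w < 2 * ρ / 3 := hyw
    linarith [dist_triangle (y' + k) y' w]
  have h1 := hmem h' rfl y'
  have h2 := hmem (-h') (norm_neg _) y'
  have e1 : (y' : X) - ↑(y' + h') = -h c n := by simp [y', h']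
  have e2 : (y' : X) - ↑(y' + -h') = h c n := by simp [y', h']
  rw [e1, map_neg, norm_neg] at h1
  rw [e2] at h2
  have e3 : ((y' + h' : closedSpan C.1) : X) = y c n + h c n := rfl
  have e4 : ((y' + -h' : closedSpan C.1) : X) = y c n - h c n := by simp [y', h', sub_eq_add_neg]
  rw [e3] at h1
  rw [e4] at h2
  have e5 : f y' = f (y c n) := rfl
  linarith

theorem isAsplund_of_isCofinal_surjective [CompleteSpace X] {A : Set (Rectangle X)}
    (hA : IsCofinal A) (hs : ∀ R ∈ A, Function.Surjective (Rectangle.restrict R)) :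
    IsAsplund X := by
  intro f hf hc
  have hX : ∀ C : CountableSubset X, ∃ D : CountableSubset (StrongDual ℝ X),
      ∀ (p : StrongDual ℝ X) (ε : ℝ), 0 < ε →
        ∃ d ∈ D.1, ∀ w ∈ closedSpan C.1, |p w - d w| ≤ ε * ‖w‖ := fun C => by
    obtain ⟨R, hR, hCR⟩ := hA (sepSpan C, sepSpan ⟨∅, countable_empty⟩)
    obtain ⟨D, -, hD, hDd⟩ := R.2.2.2.exists_countable_dense_subset
    refine ⟨⟨D, hD⟩, fun p ε hε => ?_⟩
    obtain ⟨y, hy⟩ := hs R hR (restrict R.1.1 p)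
    obtain ⟨d, hd, hyd⟩ := Metric.mem_closure_iff.1 (hDd y.2) ε hε
    refine ⟨d, hd, fun w hw => ?_⟩
    have hpw : p w = y.1 w := (DFunLike.congr_fun hy (⟨w, hCR.1 hw⟩ : R.1.1)).symm
    rw [dist_eq_norm] at hyd
    rw [hpw]
    exact (y.1 - d).le_of_opNorm_le hyd.le w
  obtain ⟨x, hx⟩ := (dense_iInter_of_isOpen_nat
    (fun n : ℕ => isOpen_smallSecondDiff f (1 / (n + 1)))
    fun n => dense_smallSecondDiff hf hc hX Nat.one_div_pos_of_nat).nonempty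
  exact ⟨x, differentiableAt_of_smallSecondDiff hf hc (mem_iInter.1 hx)⟩

end Asplund

theorem theorem2p2 (X : Type*) [NormedAddCommGroup X] [NormedSpace ℝ X] [CompleteSpace X] :
    List.TFAE [
      Asplund.IsAsplund X,
      ∃ G : Asplund.CountableSubset X → Asplund.CountableSubset (StrongDual ℝ X),
        Asplund.IsAsplundGenerator G,
      ∃ A : Set (Asplund.Rectangle X), Asplund.Rich A ∧
        (∀ R₁ ∈ A, ∀ R₂ ∈ A, R₁.1 ≤ R₂.1 → R₁.2 ≤ R₂.2) ∧
        (∀ R ∈ A, Isometry (Asplund.Rectangle.restrict R) ∧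
          Function.Surjective (Asplund.Rectangle.restrict R)),
      ∃ A : Set (Asplund.Rectangle X), IsCofinal A ∧
        ∀ R ∈ A, Function.Surjective (Asplund.Rectangle.restrict R)] := by
  tfae_have 1 → 2 := fun h => h.exists_isAsplundGenerator
  tfae_have 2 → 3 := fun ⟨_, hG⟩ => hG.exists_rich
  tfae_have 3 → 4 := fun ⟨A, hA, _, h⟩ => ⟨A, hA.1, fun R hR => (h R hR).2⟩
  tfae_have 4 → 1 := fun ⟨_, hA, h⟩ => Asplund.isAsplund_of_isCofinal_surjective hA h
  tfae_finish
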